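/- Let $L$ be a signature consisting of countably many relation symbols $(R_i)_i$ of finite or countably infinite arities $(r_i)_i$. A Borel $L$-structure $\mathcal{G}$ on a Polish space $X$ is a family of Borel sets $R_i^{\mathcal{G}}\subseteq X^{r_i}$. If $\mathcal{G}$, $\mathcal{H}$ are Borel $L$-structures on Polish spaces $X$, $Y$, a Borel homomorphism from $\mathcal{G}$ to $\mathcal{H}$ is a Borel map $\phi:X\to Y$ such that for every $i$ and every $x=(x_j)_{j<r_i}\in R_i^{\mathcal{G}}$ we have $(\phi(x_j))_{j<r_i}\in R_i^{\mathcal{H}}$. For $c\in\mathbb{N}^{\mathbb{N}}$ let $((c)_i)_{i\in\mathbb{N}}$ be the sequence of elements of $\mathbb{N}^{\mathbb{N}}$ given by $(c)_i(k)=c(\langle i,k\rangle)$, where $\langle\cdot,\cdot\rangle:\mathbb{N}^2\to\mathbb{N}$ is a pairing bijection. Borel codes for subsets of a Polish space $Z$ with an enumerated basis $(U_n)_{n\in\mathbb{N}}$ are defined inductively: if $c(0)=0$, then $c$ is a Borel code of $U_{c(1)}$; if $c(0)\neq 0$, $c'(k)=c(k+1)$, and $(c')_n$ is a Borel code of $B_n$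 for every $n$, then $c$ is a Borel code of $\bigcup_n (Z\setminus B_n)$. For every arity $a\in\{0,1,2,\dots\}\cup\{\infty\}$ fix an enumerated basis of $X^a$. We say that $c\in\mathbb{N}^{\mathbb{N}}$ codes the Borel $L$-structure $\mathcal{G}$ on $X$ if for every $i$, $(c)_i$ is a Borel code of $R_i^{\mathcal{G}}\subseteq X^{r_i}$. Then for all Polish spaces $X$, $Y$ and every Borel $L$-structure $\mathcal{H}$ on $Y$ the set \[S=\{c\in\mathbb{N}^{\mathbb{N}}: c \text{ codes a Borel } L\text{-structure on } X \text{ that admits a Borel homomorphism to } \mathcal{H}\}\] is $\mathbf{\Sigma}^1_2$, i.e., the projection to $\mathbb{N}^{\mathbb{N}}$ of a co-analytic subset of $\mathbb{N}^{\mathbb{N}}\times\mathbb{N}^{\mathbb{N}}$. -/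

import Mathlib

open Set MeasureTheory TopologicalSpace

/-- The Baire space of infinite sequences of natural numbers. -/
abbrev Baire : Type := ℕ → ℕ

/-- Co-analytic sets: complements of analytic sets. -/
def CoanalyticSet {Z : Type*} [TopologicalSpace Z] (s : Set Z) : Prop :=
  AnalyticSet sᶜ

/-- Boldface `Σ¹₂` sets: projections of co-analytic subsets of `Z × ℕ^ℕ`. -/
def IsSigma12 {Z : Type*} [TopologicalSpace Z] (s : Set Z) : Prop :=
  ∃ C : Set (Z × Baire), CoanalyticSet C ∧ s = Prod.fst '' C

/-- `X^a` for a finite or countably infinite arity `a`: families `(x_j)_{j < a}`,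
with the product topology and the product Borel structure. -/
abbrev Tuple (X : Type*) (a : ℕ∞) : Type _ := {j : ℕ // (j : ℕ∞) < a} → X

/-- The `i`-th element `(c)_i` of the sequence of elements of Baire space coded by `c`. -/
def Baire.row {ι : Type*} [Encodable ι] (c : Baire) (i : ι) : Baire :=
  fun k => c (Nat.pair (Encodable.encode i) k)

/-- The tail of `c`, with the first entry removed. -/
def Baire.tail (c : Baire) : Baire := fun k => c (k + 1)

/-- `BorelCodes U c B`: `c` is a Borel code, and the set it codes is `B`, where `U` enumerates
a countable basis of the space `Z`. If `c(0) = 0` then `c` codes the basic open set with number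
`c(1)`; otherwise `c` codes `⋃ₙ (Z \ Bₙ)` where the `n`-th element of the sequence coded by the
tail of `c` is a code of `Bₙ`. -/
inductive BorelCodes {Z : Type*} (U : ℕ → Set Z) : Baire → Set Z → Prop
  | basic (c : Baire) (h : c 0 = 0) : BorelCodes U c (U (c 1))
  | node (c : Baire) (h : c 0 ≠ 0) (B : ℕ → Set Z)
      (hB : ∀ n, BorelCodes U (c.tail.row n) (B n)) : BorelCodes U c (⋃ n, (B n)ᶜ)

/-- A Borel structure on `X` for the signature with relation symbols `(R_i)_{i : ι}` of
arities `(r_i)_{i : ι}`. -/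
structure BorelStructure {ι : Type*} (r : ι → ℕ∞) (X : Type*) [MeasurableSpace X] where
  rel : ∀ i, Set (Tuple X (r i))
  measurableSet_rel : ∀ i, MeasurableSet (rel i)

/-- `φ` is a Borel homomorphism from `G` to `H`. -/
def IsBorelHom {ι : Type*} {r : ι → ℕ∞} {X Y : Type*} [MeasurableSpace X] [MeasurableSpace Y]
    (G : BorelStructure r X) (H : BorelStructure r Y) (φ : X → Y) : Prop :=
  Measurable φ ∧ ∀ i, ∀ x : Tuple X (r i), x ∈ G.rel i → (fun j => φ (x j)) ∈ H.rel i

/-- `c` codes the Borel structure `G`: for every `i`, `(c)_i` is a Borel code of the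
interpretation of `R_i`. Here `U a` enumerates a basis of `X^a`. -/
def CodesStructure {ι : Type*} [Encodable ι] {r : ι → ℕ∞} {X : Type*} [MeasurableSpace X]
    (U : ∀ a : ℕ∞, ℕ → Set (Tuple X a)) (c : Baire) (G : BorelStructure r X) : Prop :=
  ∀ i, BorelCodes (U (r i)) (c.row i) (G.rel i)

/-! A homomorphism is a Borel map, so it can itself be coded by an element `d` of Baire space; the
point is to do this so that "`d` codes a homomorphism from the structure coded by `c`" is
co-analytic. Embed `Y` in Cantor space by a Borel injection `e`. By Lusin–Souslin its range and the
images of the relations of `H` are Borel, so a map into `Y` becomes a map into Cantor space with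
values in `range e`, given by a sequence of Borel codes for its coordinates (`exists_hom_iff`).

Being a Borel code is well-foundedness of a tree, hence co-analytic (`not_exists_iff`). Membership
in a coded set is witnessed by a truth labelling of the tree, `IsEval`: this is a Borel condition, a
labelling exists for every code, and its root value is forced (`exists_isEval`, `IsEval.root_iff`).
A failure of the homomorphism conditions is then the existence of a point or tuple with labellings
showing it, an analytic condition (`coanalyticSet_homCodes`). -/

namespace BorelCodes

/-! ### Borel codes, their trees and their evaluations. -/

section Codes

variable {Z : Type*} {U : ℕ → Set Z}

/-- The set coded by `c`, empty if `c` is not a Borel code. -/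
def val (U : ℕ → Set Z) (c : Baire) : Set Z := {x | ∃ B, BorelCodes U c B ∧ x ∈ B}

theorem unique {c : Baire} {B B' : Set Z} (h : BorelCodes U c B) (h' : BorelCodes U c B') :
    B = B' := by
  induction h generalizing B' with
  | basic c h =>
    cases h' with
    | basic _ _ => rfl
    | node _ h₁ _ _ => exact absurd h h₁
  | node c h B hB ih =>
    cases h' with
    | basic _ h₁ => exact absurd h₁ h
    | node _ h₁ B₁ hB₁ =>
      have : B = B₁ := funext fun n => ih n (hB₁ n)
      rw [this]

theorem val_eq {c : Baire} {B : Set Z} (h : BorelCodes U c B) : val U c = B := by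
  ext x
  constructor
  · rintro ⟨B', h', hx⟩
    rwa [h.unique h']
  · exact fun hx => ⟨B, h, hx⟩

theorem measurableSet [MeasurableSpace Z] (hU : ∀ n, MeasurableSet (U n)) {c : Baire} {B : Set Z}
    (h : BorelCodes U c B) : MeasurableSet B := by
  induction h with
  | basic c h => exact hU _
  | node c h B hB ih => exact MeasurableSet.iUnion fun n => (ih n).compl

/-- The element of Baire space whose rows are the given sequences. -/
def ofRows (d : ℕ → Baire) : Baire := fun k => d k.unpair.1 k.unpair.2

theorem row_ofRows (d : ℕ → Baire) (n : ℕ) : (ofRows d).row n = d n := by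
  funext k
  simp [Baire.row, ofRows]

/-- The code of the union of the complements of the sets coded by the given sequences. -/
def nodeCode (d : ℕ → Baire) : Baire
  | 0 => 1
  | k + 1 => ofRows d k

theorem nodeCode_spec {d : ℕ → Baire} {B : ℕ → Set Z} (h : ∀ n, BorelCodes U (d n) (B n)) :
    BorelCodes U (nodeCode d) (⋃ n, (B n)ᶜ) := by
  refine node _ (by simp [nodeCode]) B fun n => ?_
  have : (nodeCode d).tail = ofRows d := rfl
  rw [this, row_ofRows]
  exact h n

theorem exists_compl {B : Set Z} (h : ∃ c, BorelCodes U c B) : ∃ c, BorelCodes U c Bᶜ := by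
  obtain ⟨c, hc⟩ := h
  refine ⟨nodeCode fun _ => c, ?_⟩
  simpa [iUnion_const] using nodeCode_spec (fun _ : ℕ => hc)

theorem exists_iUnion {B : ℕ → Set Z} (h : ∀ n, ∃ c, BorelCodes U c (B n)) :
    ∃ c, BorelCodes U c (⋃ n, B n) := by
  choose d hd using fun n => exists_compl (h n)
  refine ⟨nodeCode d, ?_⟩
  simpa using nodeCode_spec hd

theorem exists_basic (n : ℕ) : ∃ c, BorelCodes U c (U n) :=
  -- The sequence `k * n` has value `0` at `0` and `n` at `1`.
  ⟨fun k => k * n, by simpa using basic (U := U) (fun k => k * n) (by simp)⟩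

theorem exists_of_measurableSet {B : Set Z}
    (h : @MeasurableSet Z (MeasurableSpace.generateFrom (range U)) B) :
    ∃ c, BorelCodes U c B := by
  refine MeasurableSpace.generateFrom_induction (range U)
    (fun s _ => ∃ c, BorelCodes U c s) ?_ ?_ ?_ ?_ B h
  · rintro _ ⟨n, rfl⟩ -
    exact exists_basic n
  -- The empty set is coded as the complement of `U 0 ∪ (U 0)ᶜ`.
  · have h₁ : ∀ n, ∃ c, BorelCodes U c (if n = 0 then U 0 else (U 0)ᶜ) := by
      intro n
      split_ifs
      · exact exists_basic 0
      · exact exists_compl (exists_basic 0)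
    have h₂ : (⋃ n : ℕ, if n = 0 then U 0 else (U 0)ᶜ) = univ := by
      ext x
      by_cases hx : x ∈ U 0
      · simpa using ⟨0, by simpa using hx⟩
      · simpa using ⟨1, by simpa using hx⟩
    simpa [h₂] using exists_compl (exists_iUnion h₁)
  · exact fun s _ hs => exists_compl hs
  · exact fun s _ hs => exists_iUnion hs

/-- A sequence fails to be a Borel code iff its tree has an infinite branch. -/
theorem not_exists_iff {c : Baire} : (¬ ∃ B, BorelCodes U c B) ↔
    ∃ p : ℕ → Baire, p 0 = c ∧ ∀ k, p k 0 ≠ 0 ∧ ∃ n : ℕ, p (k + 1) = (p k).tail.row n := by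
  constructor
  · intro hc
    -- A non-code is not a leaf and has a child that is a non-code; iterating a choice of such
    -- children gives the branch.
    have step : ∀ c : {c : Baire // ¬ ∃ B, BorelCodes U c B},
        c.1 0 ≠ 0 ∧ ∃ c' : {c : Baire // ¬ ∃ B, BorelCodes U c B},
          ∃ n : ℕ, c'.1 = c.1.tail.row n := by
      rintro ⟨c, hc⟩
      have h0 : c 0 ≠ 0 := fun h0 => hc ⟨_, basic c h0⟩
      refine ⟨h0, ?_⟩
      by_contra hn
      have h₁ : ∀ n : ℕ, ∃ B, BorelCodes U (c.tail.row n) B := fun n => by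
        by_contra h
        exact hn ⟨⟨_, h⟩, n, rfl⟩
      choose B hB using h₁
      exact hc ⟨_, node c h0 B hB⟩
    choose h0 next hnext using step
    refine ⟨fun k => (next^[k] ⟨c, hc⟩).1, rfl, fun k => ⟨h0 _, ?_⟩⟩
    simp only [Function.iterate_succ_apply']
    exact hnext _
  · rintro ⟨p, rfl, hp⟩ ⟨B, hB⟩
    generalize hc : p 0 = c at hB
    induction hB generalizing p with
    | basic c h => exact (hp 0).1 (hc ▸ h)
    | node c h B hB ih =>
      obtain ⟨n, hn⟩ := (hp 0).2
      exact ih n (fun k => p (k + 1)) (fun k => hp (k + 1)) (by rw [← hc]; exact hn)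

/-- The `n`-th child of a code; the children of a code of a basic open set are that code itself. -/
def child (c : Baire) (n : ℕ) : Baire := if c 0 = 0 then c else c.tail.row n

/-- The code at the position `s` of the tree of codes below `c`. -/
def subcode (c : Baire) (s : List ℕ) : Baire := s.foldl child c

theorem subcode_cons (c : Baire) (n : ℕ) (s : List ℕ) :
    subcode c (n :: s) = subcode (child c n) s := rfl

theorem subcode_append (c : Baire) (s : List ℕ) (n : ℕ) :
    subcode c (s ++ [n]) = child (subcode c s) n := by
  simp [subcode]

theorem exists_child {c : Baire} (h : ∃ B, BorelCodes U c B) (n : ℕ) :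
    ∃ B, BorelCodes U (child c n) B := by
  obtain ⟨B, hB⟩ := h
  cases hB with
  | basic _ h => exact ⟨_, by simpa [child, h] using basic (U := U) c h⟩
  | node _ h B hB => exact ⟨B n, by simpa [child, h] using hB n⟩

theorem exists_subcode {c : Baire} (h : ∃ B, BorelCodes U c B) (s : List ℕ) :
    ∃ B, BorelCodes U (subcode c s) B := by
  induction s generalizing c with
  | nil => exact h
  | cons n s ih => exact ih (exists_child h n)

/-- `f` labels each position of the tree of codes below `c` by the truth value of the membership of
`x` in the set coded there. -/
def IsEval (U : ℕ → Set Z) (c : Baire) (x : Z) (f : List ℕ → Bool) : Prop :=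
  ∀ s, (subcode c s 0 = 0 → (f s = true ↔ x ∈ U (subcode c s 1))) ∧
    (subcode c s 0 ≠ 0 → (f s = true ↔ ∃ n, f (s ++ [n]) = false))

/-- By well-founded induction the labels are forced from the leaves upwards. For a non-code the root
label need not be determined. -/
theorem IsEval.root_iff {c : Baire} {B : Set Z} (h : BorelCodes U c B) {x : Z}
    {f : List ℕ → Bool} (hf : IsEval U c x f) : f [] = true ↔ x ∈ B := by
  induction h generalizing f with
  | basic c h => exact (hf []).1 h
  | node c h B hB ih =>
    have h₁ : ∀ n, f [n] = true ↔ x ∈ B n := fun n => by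
      refine ih n (f := fun s => f (n :: s)) fun s => ?_
      have h₂ := hf (n :: s)
      have h₃ : child c n = c.tail.row n := if_neg h
      rwa [subcode_cons, h₃] at h₂
    rw [(hf []).2 h, mem_iUnion]
    refine exists_congr fun n => ?_
    rw [mem_compl_iff, ← h₁ n]
    simp

theorem exists_isEval {c : Baire} (h : ∃ B, BorelCodes U c B) (x : Z) :
    ∃ f, IsEval U c x f := by
  classical
  refine ⟨fun s => decide (x ∈ val U (subcode c s)), fun s => ?_⟩
  simp only [decide_eq_true_eq, decide_eq_false_iff_not, subcode_append]
  obtain ⟨B, hB⟩ := exists_subcode h s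
  generalize subcode c s = c' at hB
  cases hB with
  | basic _ h => exact ⟨fun _ => by rw [(basic (U := U) c' h).val_eq], fun h' => absurd h h'⟩
  | node _ h B hB =>
    refine ⟨fun h' => absurd h' h, fun _ => ?_⟩
    rw [(node c' h B hB).val_eq, mem_iUnion]
    refine exists_congr fun n => ?_
    have : child c' n = c'.tail.row n := if_neg h
    rw [this, (hB n).val_eq, mem_compl_iff]

end Codes

/-! ### Evaluation is Borel; failing to be a code is analytic. -/

section Measurability

theorem measurable_row {ι : Type*} [Encodable ι] (i : ι) :
    Measurable fun c : Baire => c.row i :=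
  measurable_pi_lambda _ fun _ => measurable_pi_apply _

theorem measurable_tail : Measurable Baire.tail :=
  measurable_pi_lambda _ fun _ => measurable_pi_apply _

theorem measurable_child (n : ℕ) : Measurable fun c : Baire => child c n :=
  Measurable.ite (measurable_pi_apply 0 (measurableSet_singleton 0)) measurable_id
    ((measurable_row n).comp measurable_tail)

theorem measurable_subcode (s : List ℕ) : Measurable fun c : Baire => subcode c s := by
  induction s with
  | nil => exact measurable_id
  | cons n s ih => exact ih.comp (measurable_child n)

theorem measurableSet_isEval {α Z : Type*} [MeasurableSpace α] [MeasurableSpace Z]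
    {U : ℕ → Set Z} (hU : ∀ n, MeasurableSet (U n)) {c : α → Baire} {x : α → Z}
    {f : α → List ℕ → Bool} (hc : Measurable c) (hx : Measurable x) (hf : Measurable f) :
    MeasurableSet {a | IsEval U (c a) (x a) (f a)} := by
  have hcs : ∀ s k, Measurable fun a => subcode (c a) s k := fun s k =>
    (measurable_pi_apply k).comp ((measurable_subcode s).comp hc)
  have hfs : ∀ s b, MeasurableSet {a | f a s = b} := fun s b =>
    ((measurable_pi_apply s).comp hf) (measurableSet_singleton b)
  have h0 : ∀ s, MeasurableSet {a | subcode (c a) s 0 = 0} := fun s =>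
    hcs s 0 (measurableSet_singleton 0)
  have h1 : ∀ s, MeasurableSet {a | x a ∈ U (subcode (c a) s 1)} := fun s => by
    have : {a | x a ∈ U (subcode (c a) s 1)} =
        ⋃ n, {a | subcode (c a) s 1 = n} ∩ x ⁻¹' U n := by
      ext a
      simp
    rw [this]
    exact MeasurableSet.iUnion fun n =>
      (hcs s 1 (measurableSet_singleton n)).inter (hx (hU n))
  have h2 : ∀ s, MeasurableSet {a | ∃ n, f a (s ++ [n]) = false} := fun s => by
    rw [ofPred_exists]
    exact MeasurableSet.iUnion fun n => hfs _ _
  simp only [IsEval, ofPred_forall]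
  refine MeasurableSet.iInter fun s => ?_
  exact ((h0 s).imp ((hfs s true).iff (h1 s))).inter ((h0 s).compl.imp ((hfs s true).iff (h2 s)))

theorem analyticSet_not_exists {α Z : Type*} (U : ℕ → Set Z) [TopologicalSpace α]
    [PolishSpace α] [MeasurableSpace α] [BorelSpace α] {c : α → Baire} (hc : Measurable c) :
    AnalyticSet {a | ¬ ∃ B, BorelCodes U (c a) B} := by
  have hm : MeasurableSet {q : α × (ℕ → Baire) | q.2 0 = c q.1 ∧
      ∀ k, q.2 k 0 ≠ 0 ∧ ∃ n : ℕ, q.2 (k + 1) = (q.2 k).tail.row n} := by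
    have hp : ∀ k, Measurable fun q : α × (ℕ → Baire) => q.2 k := fun k =>
      (measurable_pi_apply k).comp measurable_snd
    simp only [ofPred_and, ofPred_forall, ofPred_exists]
    refine (measurableSet_eq_fun (hp 0) (hc.comp measurable_fst)).inter ?_
    refine MeasurableSet.iInter fun k => MeasurableSet.inter ?_ ?_
    · exact ((measurable_pi_apply 0).comp (hp k)) (measurableSet_singleton 0).compl
    · exact MeasurableSet.iUnion fun n => measurableSet_eq_fun (hp (k + 1))
        ((measurable_row n).comp (measurable_tail.comp (hp k)))
  have ha := hm.analyticSet_image measurable_fst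
  convert ha using 1
  ext a
  rw [mem_ofPred_eq, not_exists_iff]
  simp

end Measurability

end BorelCodes

/-! ### Coding maps into Cantor space. -/

open BorelCodes

/-- The map into Cantor space whose `n`-th coordinate is the indicator of the set coded by the
`n`-th row of `d`. -/
noncomputable def codedMap {X : Type*} (V : ℕ → Set X) (d : Baire) (x : X) : ℕ → Bool :=
  open Classical in fun n => decide (x ∈ val V (d.row n))

theorem measurable_codedMap {X : Type*} [MeasurableSpace X] {V : ℕ → Set X}
    (hV : ∀ n, MeasurableSet (V n)) {d : Baire} (hd : ∀ n : ℕ, ∃ B, BorelCodes V (d.row n) B) :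
    Measurable (codedMap V d) := by
  refine measurable_pi_lambda _ fun n => measurable_to_bool ?_
  obtain ⟨B, hB⟩ := hd n
  have : (fun x => codedMap V d x n) ⁻¹' {true} = B := by
    ext x
    simp [codedMap, hB.val_eq]
  rw [this]
  exact hB.measurableSet hV

theorem exists_codedMap_eq {X : Type*} [m : MeasurableSpace X] {V : ℕ → Set X}
    (hV : MeasurableSpace.generateFrom (range V) = m) {g : X → ℕ → Bool} (hg : Measurable g) :
    ∃ d : Baire, (∀ n : ℕ, ∃ B, BorelCodes V (d.row n) B) ∧ codedMap V d = g := by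
  have h : ∀ n, ∃ c, BorelCodes V c {x | g x n = true} := fun n => by
    refine exists_of_measurableSet ?_
    rw [hV]
    exact ((measurable_pi_apply n).comp hg) (measurableSet_singleton true)
  choose c hc using h
  refine ⟨ofRows c, fun n => ⟨_, by rw [row_ofRows]; exact hc n⟩, ?_⟩
  funext x n
  rw [codedMap, row_ofRows, (hc n).val_eq]
  simp

theorem isEval_root_eq_codedMap {X : Type*} {V : ℕ → Set X} {d : Baire}
    (hd : ∀ n : ℕ, ∃ B, BorelCodes V (d.row n) B) {x : X} {F : ℕ → List ℕ → Bool}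
    (hF : ∀ n, IsEval V (d.row n) x (F n)) : (fun n => F n []) = codedMap V d x := by
  funext n
  obtain ⟨B, hB⟩ := hd n
  rw [Bool.eq_iff_iff, (hF n).root_iff hB]
  simp [codedMap, hB.val_eq]

/-- The coding of homomorphisms: a pair `(c, d)` where `c` codes a structure and `d` codes a map into
Cantor space that takes values in `T` and sends the relation coded by the row `i` of `c` into `R i`. -/
def homCodes {ι : Type*} [Encodable ι] {r : ι → ℕ∞} {X : Type*}
    (U : ∀ a : ℕ∞, ℕ → Set (Tuple X a)) (V : ℕ → Set X) (T : Set (ℕ → Bool))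
    (R : ∀ i, Set (Tuple (ℕ → Bool) (r i))) : Set (Baire × Baire) :=
  {p | (∀ i : ι, ∃ B, BorelCodes (U (r i)) (p.1.row i) B) ∧
    (∀ n : ℕ, ∃ B, BorelCodes V (p.2.row n) B) ∧ (∀ x, codedMap V p.2 x ∈ T) ∧
    ∀ i, ∀ x ∈ val (U (r i)) (p.1.row i), (fun j => codedMap V p.2 (x j)) ∈ R i}

/-! ### The set of codes of homomorphisms is co-analytic. -/

section Complexity

theorem analyticSet_union {Z : Type*} [TopologicalSpace Z] {s t : Set Z} (hs : AnalyticSet s)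
    (ht : AnalyticSet t) : AnalyticSet (s ∪ t) := by
  rw [union_eq_iUnion]
  exact AnalyticSet.iUnion (Bool.rec ht hs)

variable {X : Type*} [TopologicalSpace X] [PolishSpace X] [MeasurableSpace X] [BorelSpace X]

/-- The labellings `F` replace `codedMap`, so the set is a projection of a Borel set. The rows of
`p.2` need not be codes here. -/
theorem analyticSet_exists_eval_notMem {V : ℕ → Set X} (hV : ∀ n, MeasurableSet (V n))
    {T : Set (ℕ → Bool)} (hT : MeasurableSet T) :
    AnalyticSet {p : Baire × Baire | ∃ (x : X) (F : ℕ → List ℕ → Bool),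
      (∀ n, IsEval V (p.2.row n) x (F n)) ∧ (fun n => F n []) ∉ T} := by
  have hm : MeasurableSet {q : (Baire × Baire) × X × (ℕ → List ℕ → Bool) |
      (∀ n, IsEval V (q.1.2.row n) q.2.1 (q.2.2 n)) ∧ (fun n => q.2.2 n []) ∉ T} := by
    simp only [ofPred_and, ofPred_forall]
    refine MeasurableSet.inter ?_ ?_
    · refine MeasurableSet.iInter fun n => measurableSet_isEval hV
        ((measurable_row n).comp (by fun_prop)) (by fun_prop) (by fun_prop)
    · have : Measurable fun q : (Baire × Baire) × X × (ℕ → List ℕ → Bool) =>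
          fun n => q.2.2 n [] := by fun_prop
      exact this hT.compl
  have ha := hm.analyticSet_image measurable_fst
  convert ha using 1
  ext p
  simp

theorem analyticSet_exists_eval_mem_notMem {a : ℕ∞} {U : ℕ → Set (Tuple X a)}
    (hU : ∀ n, MeasurableSet (U n)) {V : ℕ → Set X} (hV : ∀ n, MeasurableSet (V n))
    {R : Set (Tuple (ℕ → Bool) a)} (hR : MeasurableSet R) {ι : Type*} [Encodable ι] (i : ι) :
    AnalyticSet {p : Baire × Baire | ∃ (x : Tuple X a) (f : List ℕ → Bool)
      (F : {j : ℕ // (j : ℕ∞) < a} → ℕ → List ℕ → Bool),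
      IsEval U (p.1.row i) x f ∧ f [] = true ∧ (∀ j n, IsEval V (p.2.row n) (x j) (F j n)) ∧
      (fun j n => F j n []) ∉ R} := by
  have hm : MeasurableSet {q : (Baire × Baire) × Tuple X a × (List ℕ → Bool) ×
      ({j : ℕ // (j : ℕ∞) < a} → ℕ → List ℕ → Bool) |
      IsEval U (q.1.1.row i) q.2.1 q.2.2.1 ∧ q.2.2.1 [] = true ∧
      (∀ j n, IsEval V (q.1.2.row n) (q.2.1 j) (q.2.2.2 j n)) ∧
      (fun j n => q.2.2.2 j n []) ∉ R} := by
    simp only [ofPred_and, ofPred_forall]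
    refine MeasurableSet.inter ?_ (MeasurableSet.inter ?_ (MeasurableSet.inter ?_ ?_))
    · exact measurableSet_isEval hU ((measurable_row i).comp (by fun_prop)) (by fun_prop)
        (by fun_prop)
    · exact measurableSet_eq_fun (by fun_prop) measurable_const
    · refine MeasurableSet.iInter fun j => MeasurableSet.iInter fun n => measurableSet_isEval hV
        ((measurable_row n).comp (by fun_prop)) (by fun_prop) (by fun_prop)
    · have : Measurable fun q : (Baire × Baire) × Tuple X a × (List ℕ → Bool) ×
          ({j : ℕ // (j : ℕ∞) < a} → ℕ → List ℕ → Bool) =>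
          fun j n => q.2.2.2 j n [] := by fun_prop
      exact this hR.compl
  have ha := hm.analyticSet_image measurable_fst
  convert ha using 1
  ext p
  simp

/-- The complement is a union of four analytic sets. The two about labellings express the intended
failures only when all rows are codes, but otherwise one of the first two already contains the pair.
-/
theorem coanalyticSet_homCodes {ι : Type*} [Encodable ι] {r : ι → ℕ∞}
    {U : ∀ a : ℕ∞, ℕ → Set (Tuple X a)} (hU : ∀ a n, MeasurableSet (U a n))
    {V : ℕ → Set X} (hV : ∀ n, MeasurableSet (V n)) {T : Set (ℕ → Bool)} (hT : MeasurableSet T)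
    {R : ∀ i, Set (Tuple (ℕ → Bool) (r i))} (hR : ∀ i, MeasurableSet (R i)) :
    CoanalyticSet (homCodes U V T R) := by
  have hA := AnalyticSet.iUnion fun i : ι => analyticSet_not_exists (U (r i))
    (c := fun p : Baire × Baire => p.1.row i) ((measurable_row i).comp measurable_fst)
  have hB := AnalyticSet.iUnion fun n : ℕ => analyticSet_not_exists V
    (c := fun p : Baire × Baire => p.2.row n) ((measurable_row n).comp measurable_snd)
  have hC := analyticSet_exists_eval_notMem hV hT
  have hD := AnalyticSet.iUnion fun i : ι =>
    analyticSet_exists_eval_mem_notMem (hU (r i)) hV (hR i) i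
  rw [CoanalyticSet]
  convert analyticSet_union hA (analyticSet_union hB (analyticSet_union hC hD)) using 1
  ext p
  simp only [homCodes, mem_compl_iff, mem_ofPred_eq, mem_union, mem_iUnion]
  by_cases h₁ : ∀ i : ι, ∃ B, BorelCodes (U (r i)) (p.1.row i) B
  swap
  · simp only [h₁, false_and, not_false_eq_true, true_iff]
    exact Or.inl (not_forall.1 h₁)
  by_cases h₂ : ∀ n : ℕ, ∃ B, BorelCodes V (p.2.row n) B
  swap
  · simp only [h₂, false_and, and_false, not_false_eq_true, true_iff]
    exact Or.inr (Or.inl (not_forall.1 h₂))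
  simp only [h₁, h₂, not_true_eq_false, implies_true, true_and, exists_false, false_or]
  rw [not_and_or]
  choose F hF using fun x n => exists_isEval (h₂ n) x
  refine or_congr ?_ ?_
  · rw [not_forall]
    refine exists_congr fun x => ⟨fun h => ⟨F x, hF x, ?_⟩, ?_⟩
    · rwa [isEval_root_eq_codedMap h₂ (hF x)]
    · rintro ⟨G, hG, h⟩
      rwa [isEval_root_eq_codedMap h₂ hG] at h
  · rw [not_forall]
    refine exists_congr fun i => ?_
    obtain ⟨B, hB⟩ := h₁ i
    obtain ⟨f, hf⟩ := Classical.skolem.1 fun x => exists_isEval ⟨B, hB⟩ x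
    rw [hB.val_eq]
    push Not
    refine exists_congr fun x => ?_
    have key : ∀ G : {j : ℕ // (j : ℕ∞) < r i} → ℕ → List ℕ → Bool,
        (∀ j n, IsEval V (p.2.row n) (x j) (G j n)) →
        (fun j n => G j n []) = fun j => codedMap V p.2 (x j) := fun G hG =>
      funext fun j => isEval_root_eq_codedMap h₂ (hG j)
    constructor
    · rintro ⟨hx, h⟩
      refine ⟨f x, fun j => F (x j), hf x, ((hf x).root_iff hB).2 hx, fun j => hF (x j), ?_⟩
      rwa [key (fun j => F (x j)) fun j => hF (x j)]
    · rintro ⟨g, G, hg, hx, hG, h⟩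
      refine ⟨(hg.root_iff hB).1 hx, ?_⟩
      rwa [key G hG] at h

end Complexity

/-! ### Homomorphisms to `H` as coded maps into Cantor space. -/

theorem exists_hom_iff {ι : Type*} [Encodable ι] {r : ι → ℕ∞} {X Y : Type*}
    [m : MeasurableSpace X] [MeasurableSpace Y] {U : ∀ a : ℕ∞, ℕ → Set (Tuple X a)}
    (hU : ∀ a n, MeasurableSet (U a n)) {V : ℕ → Set X} (hV : ∀ n, MeasurableSet (V n))
    (hVm : MeasurableSpace.generateFrom (range V) = m) (H : BorelStructure r Y)
    {e : Y → ℕ → Bool} (he : MeasurableEmbedding e) (c : Baire) :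
    (∃ G : BorelStructure r X, CodesStructure U c G ∧ ∃ φ : X → Y, IsBorelHom G H φ) ↔
      ∃ d, (c, d) ∈ homCodes U V (range e) fun i => (fun y j => e (y j)) '' H.rel i := by
  constructor
  · rintro ⟨G, hG, φ, hφ, hom⟩
    obtain ⟨d, hd, hdφ⟩ := exists_codedMap_eq hVm (he.measurable.comp hφ)
    refine ⟨d, fun i => ⟨_, hG i⟩, hd, fun x => ?_, fun i x hx => ?_⟩
    · exact ⟨φ x, by rw [hdφ]; rfl⟩
    · rw [(hG i).val_eq] at hx
      exact ⟨_, hom i x hx, by rw [hdφ]; rfl⟩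
  · rintro ⟨d, hc, hd, hT, hR⟩
    choose B hB using hc
    choose φ hφ using hT
    have hφ' : e ∘ φ = codedMap V d := funext hφ
    refine ⟨⟨B, fun i => (hB i).measurableSet (hU (r i))⟩, hB, φ, ?_, fun i x hx => ?_⟩
    · rw [← he.measurable_comp_iff, hφ']
      exact measurable_codedMap hV hd
    · obtain ⟨y, hy, hxy⟩ := hR i x ⟨B i, hB i, hx⟩
      -- The image of the tuple lies in the image of `H.rel i`; injectivity of `e` brings it back to
      -- `H.rel i`.
      have : y = fun j => φ (x j) := funext fun j => he.injective (by
        rw [hφ]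
        exact congrFun hxy j)
      exact this ▸ hy

theorem mainTheorem5 {ι : Type*} [Encodable ι] (r : ι → ℕ∞)
    {X : Type*} [TopologicalSpace X] [PolishSpace X] [MeasurableSpace X] [BorelSpace X]
    {Y : Type*} [TopologicalSpace Y] [PolishSpace Y] [MeasurableSpace Y] [BorelSpace Y]
    (U : ∀ a : ℕ∞, ℕ → Set (Tuple X a)) (hU : ∀ a, IsTopologicalBasis (range (U a)))
    (H : BorelStructure r Y) :
    IsSigma12 {c : Baire | ∃ G : BorelStructure r X,
      CodesStructure U c G ∧ ∃ φ : X → Y, IsBorelHom G H φ} := by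
  have hUm : ∀ a n, MeasurableSet (U a n) := fun a n =>
    ((hU a).isOpen (mem_range_self n)).measurableSet
  obtain ⟨e, he, hei⟩ := MeasurableSpace.measurable_injection_nat_bool_of_countablySeparated Y
  have hemb : MeasurableEmbedding e := he.measurableEmbedding hei
  -- The code `d` is projected away, so any countable family generating the Borel sets of `X` may
  -- serve for it, independently of `U`.
  have hV := MeasurableSpace.measurableSet_natGeneratingSequence (α := X)
  have hprod : ∀ i, MeasurableSet ((fun (y : Tuple Y (r i)) j => e (y j)) '' H.rel i) := fun i => by
    have hm : Measurable fun (y : Tuple Y (r i)) j => e (y j) := by fun_prop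
    have hinj : Function.Injective fun (y : Tuple Y (r i)) j => e (y j) := fun y y' h =>
      funext fun j => hei (congrFun h j)
    exact (hm.measurableEmbedding hinj).measurableSet_image.2 (H.measurableSet_rel i)
  refine ⟨_, coanalyticSet_homCodes hUm hV hemb.measurableSet_range hprod, ?_⟩
  ext c
  rw [mem_ofPred_eq, exists_hom_iff hUm hV
    (MeasurableSpace.generateFrom_natGeneratingSequence X) H hemb c]
  simp
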